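/- Let $\mathcal H$ be a complex Hilbert space. A closed real subspace $V \subseteq \mathcal H$ is called standard if $V \cap iV = \{0\}$ and $V + iV$ is dense in $\mathcal H$. For a standard subspace $V$, let $\sigma_V$ be the closed conjugate-linear operator with domain $V + iV$ given by $\sigma_V(x+iy) = x - iy$ for $x,y \in V$, and let $\Delta_V = \sigma_V^*\sigma_V$ be its modular operator, i.e. the positive selfadjoint operator in the polar decomposition $\sigma_V = J_V\Delta_V^{1/2}$. Let $S_V = \{U \in \mathrm{U}(\mathcal H) : UV \subseteq V\}$ be the semigroup of unitary operators mapping $V$ into itself. Then, for every standard subspace $V \subseteq \mathcal H$, the following are equivalent: (a) $\Delta_V$ is bounded. (b) $V + iV = \mathcal H$. (c) If $H \supseteq V$ is a standard subspace of $\mathcal H$, then $H = V$. (d) If $H \subseteq V$ is a standard subspace of $\mathcal H$, then $H = V$. (e) The semigroup $S_V \subseteq \mathrm{U}(\mathcal H)$ is a group. -/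

import Mathlib

open scoped ComplexInnerProductSpace ComplexConjugate

namespace StandardSubspace

variable {H : Type*} [NormedAddCommGroup H] [InnerProductSpace ℂ H]

/-- A standard subspace `V` meets `i V` only in `0`, so the two summands of `x + i y`
(with `x, y` in `V`) are determined by the sum. -/
theorem decomp_unique (V : StandardSubspace H) {x y x' y' : H}
    (hx : x ∈ V.toClosedSubmodule) (hy : y ∈ V.toClosedSubmodule)
    (hx' : x' ∈ V.toClosedSubmodule) (hy' : y' ∈ V.toClosedSubmodule)
    (h : x + Complex.I • y = x' + Complex.I • y') : x = x' ∧ y = y' := by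
  have h1 : x - x' = Complex.I • (y' - y) := by
    rw [smul_sub, sub_eq_sub_iff_add_eq_add, h, add_comm]
  have hmem : x - x' ∈ V.toClosedSubmodule ⊓ V.toClosedSubmodule.mulI := by
    refine ⟨V.toClosedSubmodule.toSubmodule.sub_mem hx hx', ?_⟩
    have : x - x' ∈ V.toClosedSubmodule.mulI := by
      rw [ClosedSubmodule.mem_mapEquiv_iff, h1, scalarSMulCLE_symm_apply]
      have : (Complex.UnitI⁻¹ : ℂˣ) • (Complex.I • (y' - y)) = y' - y := by
        rw [inv_smul_eq_iff, Units.smul_def]; rfl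
      rw [this]
      exact V.toClosedSubmodule.toSubmodule.sub_mem hy' hy
    exact this
  rw [V.IsSeparating] at hmem
  have h0 : x - x' = 0 := by simpa using hmem
  refine ⟨sub_eq_zero.mp h0, ?_⟩
  rw [h0] at h1
  have h2 : y' - y = 0 := (smul_eq_zero.mp h1.symm).resolve_left Complex.I_ne_zero
  exact (sub_eq_zero.mp h2).symm

/-- The algebraic sum `V + i V` (no closure is taken), a complex subspace of `H`. -/
def addI (V : StandardSubspace H) : Submodule ℂ H where
  carrier := {z | ∃ x ∈ V.toClosedSubmodule, ∃ y ∈ V.toClosedSubmodule, x + Complex.I • y = z}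
  zero_mem' := ⟨0, V.toClosedSubmodule.toSubmodule.zero_mem, 0,
    V.toClosedSubmodule.toSubmodule.zero_mem, by simp⟩
  add_mem' := by
    rintro _ _ ⟨x, hx, y, hy, rfl⟩ ⟨x', hx', y', hy', rfl⟩
    exact ⟨x + x', V.toClosedSubmodule.toSubmodule.add_mem hx hx', y + y',
      V.toClosedSubmodule.toSubmodule.add_mem hy hy', by rw [smul_add]; abel⟩
  smul_mem' := by
    rintro c _ ⟨x, hx, y, hy, rfl⟩
    refine ⟨c.re • x - c.im • y, V.toClosedSubmodule.toSubmodule.sub_mem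
      (V.toClosedSubmodule.toSubmodule.smul_mem _ hx)
      (V.toClosedSubmodule.toSubmodule.smul_mem _ hy), c.re • y + c.im • x,
      V.toClosedSubmodule.toSubmodule.add_mem
      (V.toClosedSubmodule.toSubmodule.smul_mem _ hy)
      (V.toClosedSubmodule.toSubmodule.smul_mem _ hx), ?_⟩
    simp only [← Complex.coe_smul]
    conv_rhs => rw [← Complex.re_add_im c]
    match_scalars <;> ring_nf <;> simp [Complex.I_sq]

/-- The component `x` of `z = x + i y` in `V + i V`. -/
noncomputable def rePart (V : StandardSubspace H) (z : V.addI) : H := z.2.choose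

/-- The component `y` of `z = x + i y` in `V + i V`. -/
noncomputable def imPart (V : StandardSubspace H) (z : V.addI) : H := z.2.choose_spec.2.choose

theorem rePart_mem (V : StandardSubspace H) (z : V.addI) : V.rePart z ∈ V.toClosedSubmodule :=
  z.2.choose_spec.1

theorem imPart_mem (V : StandardSubspace H) (z : V.addI) : V.imPart z ∈ V.toClosedSubmodule :=
  z.2.choose_spec.2.choose_spec.1

theorem rePart_add_imPart (V : StandardSubspace H) (z : V.addI) :
    V.rePart z + Complex.I • V.imPart z = z :=
  z.2.choose_spec.2.choose_spec.2

theorem parts_eq (V : StandardSubspace H) (z : V.addI) {x y : H}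
    (hx : x ∈ V.toClosedSubmodule) (hy : y ∈ V.toClosedSubmodule)
    (h : x + Complex.I • y = z) : V.rePart z = x ∧ V.imPart z = y :=
  V.decomp_unique (V.rePart_mem z) (V.imPart_mem z) hx hy ((V.rePart_add_imPart z).trans h.symm)

/-- The Tomita operator `σ_V` of a standard subspace: the conjugate-linear operator with domain
`V + i V` and `σ_V (x + i y) = x - i y` for `x, y` in `V`. -/
noncomputable def tomitaOp (V : StandardSubspace H) : H →ₛₗ.[starRingEnd ℂ] H where
  domain := V.addI
  toFun :=
    { toFun := fun z => V.rePart z - Complex.I • V.imPart z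
      map_add' := by
        intro z w
        obtain ⟨h1, h2⟩ := V.parts_eq (z + w)
          (V.toClosedSubmodule.toSubmodule.add_mem (V.rePart_mem z) (V.rePart_mem w))
          (V.toClosedSubmodule.toSubmodule.add_mem (V.imPart_mem z) (V.imPart_mem w))
          (by rw [Submodule.coe_add, ← V.rePart_add_imPart z, ← V.rePart_add_imPart w, smul_add]
              abel)
        rw [h1, h2, smul_add]
        abel
      map_smul' := by
        intro c z
        obtain ⟨h1, h2⟩ := V.parts_eq (c • z)
          (x := c.re • V.rePart z - c.im • V.imPart z)
          (y := c.re • V.imPart z + c.im • V.rePart z)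
          (V.toClosedSubmodule.toSubmodule.sub_mem
            (V.toClosedSubmodule.toSubmodule.smul_mem _ (V.rePart_mem z))
            (V.toClosedSubmodule.toSubmodule.smul_mem _ (V.imPart_mem z)))
          (V.toClosedSubmodule.toSubmodule.add_mem
            (V.toClosedSubmodule.toSubmodule.smul_mem _ (V.imPart_mem z))
            (V.toClosedSubmodule.toSubmodule.smul_mem _ (V.rePart_mem z)))
          (by
            rw [Submodule.coe_smul, ← V.rePart_add_imPart z]
            simp only [← Complex.coe_smul]
            conv_rhs => rw [← Complex.re_add_im c]
            match_scalars <;> ring_nf <;> simp [Complex.I_sq])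
        rw [h1, h2]
        simp only [← Complex.coe_smul]
        have hc : conj c = (c.re : ℂ) - c.im * Complex.I := by
          apply Complex.ext <;> simp
        rw [hc]
        match_scalars <;> ring_nf <;> simp [Complex.I_sq] }

theorem tomitaOp_apply (V : StandardSubspace H) (z : V.tomitaOp.domain) {x y : H}
    (hx : x ∈ V.toClosedSubmodule) (hy : y ∈ V.toClosedSubmodule)
    (h : x + Complex.I • y = z) : V.tomitaOp z = x - Complex.I • y := by
  obtain ⟨h1, h2⟩ := V.parts_eq z hx hy h
  change V.rePart z - Complex.I • V.imPart z = _
  rw [h1, h2]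

theorem dense_addI (V : StandardSubspace H) : Dense (V.addI : Set H) := by
  have h : (V.toClosedSubmodule ⊔ V.toClosedSubmodule.mulI) ≤
      (V.addI.restrictScalars ℝ).closure := by
    refine sup_le ?_ ?_
    · intro x hx
      exact subset_closure ⟨x, hx, 0, V.toClosedSubmodule.toSubmodule.zero_mem, by simp⟩
    · intro x hx
      have hx' : x ∈ V.toClosedSubmodule.mulI := hx
      rw [ClosedSubmodule.mem_mapEquiv_iff] at hx'
      refine subset_closure ⟨0, V.toClosedSubmodule.toSubmodule.zero_mem, _, hx', ?_⟩
      rw [scalarSMulCLE_symm_apply, zero_add]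
      exact smul_inv_smul Complex.UnitI x
  rw [V.IsCyclic] at h
  intro x
  exact h (Submodule.mem_top : x ∈ (⊤ : Submodule ℝ H))

/-- The graph of `σ_V^* σ_V`, where `σ_V^*` is the adjoint of the conjugate-linear operator `σ_V`,
given by `⟪σ_V y, a⟫ = ⟪σ_V^* a, y⟫` for `y` in the domain of `σ_V`. So `(x, w)` is in the graph iff
`x` is in the domain of `σ_V`, `σ_V x` is in the domain of `σ_V^*`, and `σ_V^* (σ_V x) = w`. -/
noncomputable def modularGraph (V : StandardSubspace H) : Submodule ℂ (H × H) where
  carrier := {p | ∃ x : V.tomitaOp.domain, (x : H) = p.1 ∧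
    ∀ y : V.tomitaOp.domain, ⟪V.tomitaOp y, V.tomitaOp x⟫ = ⟪p.2, (y : H)⟫}
  zero_mem' := ⟨0, rfl, fun y => by simp⟩
  add_mem' := by
    rintro p q ⟨x, hx, h⟩ ⟨x', hx', h'⟩
    refine ⟨x + x', by simp [hx, hx'], fun y => ?_⟩
    rw [LinearPMap.map_add, inner_add_right, h, h', Prod.snd_add, inner_add_left]
  smul_mem' := by
    rintro c p ⟨x, hx, h⟩
    refine ⟨c • x, by simp [hx], fun y => ?_⟩
    rw [LinearPMap.map_smulₛₗ, inner_smul_right, h, Prod.smul_snd, inner_smul_left]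

/-- The modular operator `Δ_V = σ_V^* σ_V`, that is, the square of the positive selfadjoint part
`Δ_V^{1/2}` in the polar decomposition `σ_V = J_V Δ_V^{1/2}` of the Tomita operator. -/
noncomputable def modularOp (V : StandardSubspace H) : H →ₗ.[ℂ] H :=
  V.modularGraph.toLinearPMap

/-- The subspace `modularGraph` is a graph, and it is the graph of `modularOp`. -/
theorem graph_modularOp (V : StandardSubspace H) : V.modularOp.graph = V.modularGraph := by
  refine Submodule.toLinearPMap_graph_eq _ ?_
  rintro ⟨_, w⟩ ⟨x, rfl, h⟩ h0
  have hx : x = 0 := Subtype.ext h0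
  subst hx
  refine V.dense_addI.eq_zero_of_inner_left (𝕜 := ℂ) fun v hv => ?_
  have := h ⟨v, hv⟩
  rw [LinearPMap.map_zero, inner_zero_right] at this
  exact this.symm

/-- Consistency with the polar decomposition: whenever `σ_V = J D` with `D` selfadjoint and `J`
antiunitary, `modularOp` is the operator `D ^ 2` with its natural domain. -/
theorem modularOp_graph_of_polar [CompleteSpace H] (V : StandardSubspace H)
    (D : H →ₗ.[ℂ] H) (hD : IsSelfAdjoint D) (J : H ≃ₛₗ[starRingEnd ℂ] H)
    (hJ : ∀ a b : H, ⟪J a, J b⟫ = ⟪b, a⟫) (hdom : D.domain = V.tomitaOp.domain)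
    (hpolar : ∀ (z : V.tomitaOp.domain) (z' : D.domain), (z : H) = z' → V.tomitaOp z = J (D z'))
    (x w : H) :
    (x, w) ∈ V.modularOp.graph ↔ ∃ a : H, (x, a) ∈ D.graph ∧ (a, w) ∈ D.graph := by
  rw [graph_modularOp]
  constructor
  · rintro ⟨z, rfl, h⟩
    let z' : D.domain := ⟨z, hdom.symm.le z.2⟩
    have key : ∀ y : D.domain, ⟪w, (y : H)⟫ = ⟪D z', D y⟫ := fun y => by
      have := h ⟨y, hdom.le y.2⟩
      rw [hpolar _ y rfl, hpolar z z' rfl, hJ] at this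
      exact this.symm
    refine ⟨D z', D.mem_graph z', ?_⟩
    have hm : D z' ∈ D.adjoint.domain := LinearPMap.mem_adjoint_domain_of_exists _ ⟨w, key⟩
    have hv : D.adjoint ⟨D z', hm⟩ = w :=
      LinearPMap.adjoint_apply_eq hD.dense_domain ⟨D z', hm⟩ key
    have hg := D.adjoint.mem_graph ⟨D z', hm⟩
    rw [hv] at hg
    exact (congrArg LinearPMap.graph (LinearPMap.isSelfAdjoint_def.mp hD)).le hg
  · rintro ⟨a, h1, h2⟩
    obtain ⟨z', hz', ha⟩ := (LinearPMap.mem_graph_iff D).mp h1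
    obtain ⟨a', ha', hw⟩ := (LinearPMap.mem_graph_iff D).mp h2
    simp only at hz' ha ha' hw
    subst hz' hw
    refine ⟨⟨z', hdom.le z'.2⟩, rfl, fun y => ?_⟩
    let y' : D.domain := ⟨y, hdom.symm.le y.2⟩
    rw [hpolar y y' rfl, hpolar _ z' rfl, hJ, ha, ← ha']
    have hf := LinearPMap.adjoint_isFormalAdjoint (T := D) hD.dense_domain
    rw [LinearPMap.isSelfAdjoint_def.mp hD] at hf
    exact (hf a' y').symm

/-- The semigroup `S_V` of all unitary operators `U` on `H` with `U V ⊆ V`; it contains the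
identity, so it is a submonoid of the unitary group. -/
def unitaryEnd [CompleteSpace H] (V : StandardSubspace H) : Submonoid (unitary (H →L[ℂ] H)) where
  carrier := {U | ∀ v ∈ V.toClosedSubmodule, (U : H →L[ℂ] H) v ∈ V.toClosedSubmodule}
  one_mem' := fun _ hv => hv
  mul_mem' := fun hU hW v hv => hU _ (hW v hv)

end StandardSubspace

/-- A (possibly only partially defined) linear operator is bounded if `‖T x‖ ≤ C ‖x‖` on its domain
for some constant `C`. -/
def LinearPMap.IsBddOp {H : Type*} [NormedAddCommGroup H] [InnerProductSpace ℂ H]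
    (T : H →ₗ.[ℂ] H) : Prop :=
  ∃ C : ℝ, ∀ x : T.domain, ‖T x‖ ≤ C * ‖(x : H)‖

/-! Every condition is tied to V + iV = H. If this holds, the open mapping theorem makes (x, y) ↦ x
+ iy an isomorphism from V × V onto H. Hence σ_V and Δ_V are bounded. A standard K ⊇ V cannot be
larger, since decompositions in K + iK are unique; for a standard K ⊆ V the dense subspace K + iK is
closed, so it is H, and K = V.

Conversely, let P and Q be the real-orthogonal projections onto V and iV. Then (P + Q)/2 = (1 +
Δ_V)⁻¹ has range in V + iV (`proj_add_proj_mem_graph`), and it is onto when Δ_V is bounded. If V is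
maximal, no vector w lies outside V + iV, since V + ℝw would be standard. The symplectic complement
reverses inclusions and exchanges minimal with maximal.

For the semigroup, the isometric part J_V of P - Q is conjugate-linear and carries V onto its
symplectic complement (`exists_modularConj`). For K ⊆ V the unitary J_K⁻¹ J_V maps V into K, so if
S_V is a group then K = V. The polar decomposition behind J_V rests on a power series for the square
root. -/

/-! ### Square roots in a real Banach algebra by power series. -/

/-- The coefficients `catalan n / 4 ^ n` of the power series of `2 * (1 - √(1 - x)) / x`. -/
noncomputable def sqrtCoeff (n : ℕ) : ℝ := catalan n / 4 ^ n

theorem sqrtCoeff_nonneg (n : ℕ) : 0 ≤ sqrtCoeff n := by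
  unfold sqrtCoeff; positivity

/-- The sum telescopes. The bound 2 gives absolute convergence even on the boundary ‖T‖ = 1. -/
theorem sum_sqrtCoeff (N : ℕ) :
    ∑ n ∈ Finset.range N, sqrtCoeff n = 2 - 2 * (N.centralBinom / 4 ^ N) := by
  induction N with
  | zero => simp
  | succ N ih =>
    have h1 : ((N : ℝ) + 1) * catalan N = N.centralBinom := by
      exact_mod_cast succ_mul_catalan_eq_centralBinom N
    have h2 : ((N : ℝ) + 1) * (N + 1).centralBinom = 2 * (2 * N + 1) * N.centralBinom := by
      exact_mod_cast Nat.succ_mul_centralBinom_succ N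
    have h3 : ((N + 1).centralBinom : ℝ) = 2 * (2 * N + 1) * catalan N := by
      have hN : (N : ℝ) + 1 ≠ 0 := by positivity
      apply mul_left_cancel₀ hN
      rw [h2, ← h1]; ring
    rw [Finset.sum_range_succ, ih, h3, ← h1, sqrtCoeff, pow_succ]
    field_simp
    ring

theorem summable_sqrtCoeff : Summable sqrtCoeff := by
  refine summable_of_sum_range_le (c := 2) sqrtCoeff_nonneg fun N => ?_
  rw [sum_sqrtCoeff]
  have : (0 : ℝ) ≤ N.centralBinom / 4 ^ N := by positivity
  linarith

theorem sqrtCoeff_succ (n : ℕ) :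
    sqrtCoeff (n + 1) = 4⁻¹ * ∑ p ∈ Finset.HasAntidiagonal.antidiagonal n, sqrtCoeff p.1 * sqrtCoeff p.2 := by
  rw [Finset.mul_sum, sqrtCoeff, catalan_succ', Nat.cast_sum, Finset.sum_div]
  refine Finset.sum_congr rfl fun p hp => ?_
  rw [Finset.HasAntidiagonal.mem_antidiagonal] at hp
  rw [sqrtCoeff, sqrtCoeff, ← hp, pow_succ, pow_add]
  push_cast
  field_simp

/-- In a real Banach algebra, `1 - T` has a square root in the closed subalgebra generated by `T`
whenever `‖T‖ ≤ 1`. -/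
theorem exists_sqrt_one_sub {A : Type*} [NormedRing A] [NormedAlgebra ℝ A] [CompleteSpace A]
    (T : A) (hT : ‖T‖ ≤ 1) :
    ∃ B ∈ (Algebra.adjoin ℝ {T}).topologicalClosure, B * B = 1 - T := by
  set f : ℕ → A := fun n => sqrtCoeff n • T ^ n with hf
  have hsum : Summable fun n => ‖f (n + 1)‖ := by
    refine Summable.of_nonneg_of_le (fun _ => norm_nonneg _) (fun n => ?_)
      ((summable_nat_add_iff 1).2 summable_sqrtCoeff)
    rw [hf]
    simp only
    rw [norm_smul, Real.norm_of_nonneg (sqrtCoeff_nonneg _)]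
    refine mul_le_of_le_one_right (sqrtCoeff_nonneg _) ?_
    exact (norm_pow_le' T n.succ_pos).trans (pow_le_one₀ (norm_nonneg _) hT)
  have hsum' : Summable fun n => ‖f n‖ := (summable_nat_add_iff 1).1 hsum
  set s : A := ∑' n, f n with hs
  have hmem : s ∈ (Algebra.adjoin ℝ {T}).topologicalClosure := by
    refine (Subalgebra.isClosed_topologicalClosure _).mem_of_tendsto
      hsum'.of_norm.hasSum.tendsto_sum_nat (Filter.Eventually.of_forall fun N => ?_)
    refine Subalgebra.sum_mem _ fun n _ => Subalgebra.smul_mem _ (Subalgebra.pow_mem _ ?_ _) _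
    exact Subalgebra.le_topologicalClosure _ (Algebra.self_mem_adjoin_singleton ℝ T)
  have hTmem : T ∈ (Algebra.adjoin ℝ {T}).topologicalClosure :=
    Subalgebra.le_topologicalClosure _ (Algebra.self_mem_adjoin_singleton ℝ T)
  have hcomm : Commute T s := by
    refine Commute.tsum_right T fun n => ?_
    exact ((Commute.refl T).pow_right n).smul_right _
  -- The Catalan recursion is the quadratic equation of the generating function.
  have key : s = 1 + (4⁻¹ : ℝ) • (T * (s * s)) := by
    have h1 : s * s = ∑' n, ∑ p ∈ Finset.HasAntidiagonal.antidiagonal n, f p.1 * f p.2 :=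
      tsum_mul_tsum_eq_tsum_sum_antidiagonal_of_summable_norm hsum' hsum'
    have h2 : Summable fun n => ∑ p ∈ Finset.HasAntidiagonal.antidiagonal n, f p.1 * f p.2 :=
      (summable_norm_sum_mul_antidiagonal_of_summable_norm hsum' hsum').of_norm
    conv_lhs => rw [hs, hsum'.of_norm.tsum_eq_zero_add]
    congr 1
    · simp [hf, sqrtCoeff]
    · rw [h1, ← h2.tsum_mul_left, ← (h2.mul_left T).tsum_const_smul]
      refine tsum_congr fun n => ?_
      simp only [hf, sqrtCoeff_succ, Finset.mul_sum, Finset.smul_sum, Finset.sum_smul]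
      refine Finset.sum_congr rfl fun p hp => ?_
      rw [Finset.HasAntidiagonal.mem_antidiagonal] at hp
      rw [← hp, smul_mul_smul_comm, mul_smul_comm, smul_smul, ← pow_add, ← pow_succ']
  -- Completing the square: (1 - Ts/2)² = 1 - Ts + T²s²/4, and `key` gives T²s²/4 = Ts - T.
  refine ⟨1 - (2⁻¹ : ℝ) • (T * s), sub_mem (one_mem _)
    (Subalgebra.smul_mem _ (mul_mem hTmem hmem) _), ?_⟩
  have e : T * s * (T * s) = T * (T * (s * s)) := by
    rw [mul_assoc, ← mul_assoc s, ← hcomm.eq, mul_assoc]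
  have e2 : T * s = T + (4⁻¹ : ℝ) • (T * (T * (s * s))) := by
    conv_lhs => rw [key]
    rw [mul_add, mul_one, mul_smul_comm]
  have : (1 - (2⁻¹ : ℝ) • (T * s)) * (1 - (2⁻¹ : ℝ) • (T * s))
      = 1 - T * s + (4⁻¹ : ℝ) • (T * s * (T * s)) := by
    rw [sub_mul, mul_sub, mul_sub, smul_mul_smul_comm, one_mul, mul_one, one_mul]
    module
  rw [this, e]
  nth_rewrite 1 [e2]
  abel

/-! ### Polar decomposition on real Hilbert spaces. -/

section Polar

variable {E : Type*} [NormedAddCommGroup E] [InnerProductSpace ℝ E] [CompleteSpace E]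

/-- A selfadjoint contraction on a real Hilbert space has a selfadjoint modulus, which commutes with
everything that commutes with the square of the contraction. -/
theorem ContinuousLinearMap.exists_modulus {T : E →L[ℝ] E} (hT : IsSelfAdjoint T) (h1 : ‖T‖ ≤ 1) :
    ∃ B : E →L[ℝ] E, IsSelfAdjoint B ∧ B * B = T * T ∧
      ∀ A : E →L[ℝ] E, Commute A (T * T) → Commute A B := by
  have hTx : ∀ x, ‖T x‖ ≤ ‖x‖ := fun x => T.le_of_opNorm_le_of_le h1 le_rfl |>.trans (by simp)
  have hsym : ∀ x y, inner ℝ (T x) y = inner ℝ x (T y) := fun x y => hT.isSymmetric x y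
  -- Since ‖x - T²x‖² = ‖x‖² - 2‖Tx‖² + ‖T²x‖² ≤ ‖x‖², the square root of T² = 1 - (1 - T²) is
  -- available.
  have hn : ‖1 - T * T‖ ≤ 1 := by
    refine ContinuousLinearMap.opNorm_le_bound _ zero_le_one fun x => ?_
    rw [one_mul]
    refine (sq_le_sq₀ (norm_nonneg _) (norm_nonneg _)).1 ?_
    change ‖x - T (T x)‖ ^ 2 ≤ _
    rw [norm_sub_sq_real, ← hsym, real_inner_self_eq_norm_sq]
    have := (sq_le_sq₀ (norm_nonneg _) (norm_nonneg _)).2 (hTx (T x))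
    nlinarith [sq_nonneg ‖T x‖]
  obtain ⟨B, hB, hBB⟩ := exists_sqrt_one_sub (1 - T * T) hn
  rw [sub_sub_cancel] at hBB
  have hclos : ∀ p : (E →L[ℝ] E) → Prop, IsClosed {X | p X} →
      (∀ X ∈ Algebra.adjoin ℝ {1 - T * T}, p X) → p B := fun p hp h =>
    closure_minimal (fun X hX => h X hX) hp hB
  refine ⟨B, hclos _ (isClosed_eq continuous_star continuous_id) fun X hX => ?_, hBB,
    fun A hA => hclos _ (isClosed_eq (by fun_prop) (by fun_prop)) fun X hX => ?_⟩
  · change star X = X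
    have hc : IsSelfAdjoint (1 - T * T) := by
      refine (IsSelfAdjoint.one _).sub ?_
      simpa [hT.star_eq] using IsSelfAdjoint.star_mul_self T
    induction hX using Algebra.adjoin_induction with
    | mem x hx => rw [Set.mem_singleton_iff.1 hx]; exact hc
    | algebraMap r => rw [Algebra.algebraMap_eq_smul_one, star_smul, star_one, star_trivial]
    | add x y _ _ hx hy => rw [star_add, hx, hy]
    | mul x y hx' hy' hx hy =>
      rw [star_mul, hx, hy]
      refine (Algebra.commute_of_mem_adjoin_of_forall_mem_commute hx' fun b hb => ?_).eq
      refine (Algebra.commute_of_mem_adjoin_of_forall_mem_commute hy' fun c hc => ?_).symm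
      rw [Set.mem_singleton_iff.1 hb, Set.mem_singleton_iff.1 hc]
      exact Commute.refl _
  · exact Algebra.commute_of_mem_adjoin_of_forall_mem_commute hX fun b hb => by
      rw [Set.mem_singleton_iff.1 hb]; exact (Commute.one_right A).sub_right hA

theorem IsSelfAdjoint.denseRange_of_injective {T : E →L[ℝ] E} (hT : IsSelfAdjoint T)
    (h : Function.Injective T) : DenseRange T := by
  have : T.rangeᗮ = ⊥ := by
    rw [ContinuousLinearMap.orthogonal_range, ← ContinuousLinearMap.star_eq_adjoint, hT.star_eq]
    exact LinearMap.ker_eq_bot.2 h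
  have h2 := (Submodule.topologicalClosure_eq_top_iff).2 this
  rw [← Submodule.dense_iff_topologicalClosure_eq_top] at h2
  exact h2

/-- The orthogonal part in the polar decomposition of an injective selfadjoint contraction `T` on a
real Hilbert space intertwines what `T` intertwines. -/
theorem ContinuousLinearMap.exists_polar {T : E →L[ℝ] E} (hT : IsSelfAdjoint T) (h1 : ‖T‖ ≤ 1)
    (hinj : Function.Injective T) :
    ∃ J : E ≃ₗᵢ[ℝ] E, ∀ A A' : E →L[ℝ] E, T * A = A' * T → Commute A (T * T) →
      ∀ x, J (A x) = A' (J x) := by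
  obtain ⟨B, hB, hBB, hcomm⟩ := exists_modulus hT h1
  have hnorm : ∀ x, ‖T x‖ = ‖B x‖ := fun x => by
    have e : ∀ {S : E →L[ℝ] E}, IsSelfAdjoint S → ‖S x‖ ^ 2 = inner ℝ x ((S * S) x) := fun hS => by
      rw [← real_inner_self_eq_norm_sq]; exact hS.isSymmetric _ _
    rw [← sq_eq_sq₀ (norm_nonneg _) (norm_nonneg _), e hT, e hB, hBB]
  have hBinj : Function.Injective B := by
    refine (injective_iff_map_eq_zero B).2 fun x hx => (injective_iff_map_eq_zero T).1 hinj x ?_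
    rw [← norm_eq_zero, hnorm, hx, norm_zero]
  have hBd := hB.denseRange_of_injective hBinj
  have hTd := hT.denseRange_of_injective hinj
  let J : E ≃ₗᵢ[ℝ] E := (LinearEquiv.refl ℝ E).extendOfIsometry (B : E →ₗ[ℝ] E) (T : E →ₗ[ℝ] E)
    hBd hTd hnorm
  have hJ : ∀ x, J (B x) = T x := fun x =>
    (LinearEquiv.refl ℝ E).extendOfIsometry_eq (B : E →ₗ[ℝ] E) (T : E →ₗ[ℝ] E) hBd hTd hnorm x
  refine ⟨J, fun A A' hA hc x => ?_⟩
  -- On the dense range of B: J A B y = J B A y = T A y = A' T y = A' J B y.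
  refine hBd.induction_on (p := fun x => J (A x) = A' (J x)) x
    (isClosed_eq (J.continuous.comp A.continuous) (A'.continuous.comp J.continuous)) fun y => ?_
  have e : A (B y) = B (A y) := congr($((hcomm A hc).eq) y)
  rw [hJ, e, hJ]
  exact congr($hA y)

/-- Both (P - Q)P and (1 - Q)(P - Q) equal P - QP. The two conclusions are what `exists_polar` asks
of the pair P, 1 - Q. -/
theorem smul_sub_mul_of_idempotent {A : Type*} [Ring A] [Algebra ℝ A] {P Q : A} (c : ℝ)
    (hP : P * P = P) (hQ : Q * Q = Q) :
    c • (P - Q) * P = (1 - Q) * c • (P - Q) ∧ Commute P (c • (P - Q) * c • (P - Q)) := by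
  have h : (P - Q) * P = (1 - Q) * (P - Q) := by
    simp only [sub_mul, mul_sub, hP, hQ, one_mul]
    abel
  have hc : Commute P ((P - Q) * (P - Q)) := by
    change P * ((P - Q) * (P - Q)) = (P - Q) * (P - Q) * P
    rw [mul_assoc (P - Q) (P - Q), h, ← mul_assoc, ← mul_assoc]
    congr 1
    simp only [sub_mul, mul_sub, hP, hQ, mul_one]
    abel
  rw [smul_mul_assoc, mul_smul_comm, h]
  exact ⟨rfl, by rw [mul_smul_comm, smul_mul_assoc]; exact (hc.smul_right c).smul_right c⟩

theorem smul_sub_mul_of_exchange {A : Type*} [Ring A] [Algebra ℝ A] {P Q i : A} (c : ℝ)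
    (hP : P * i = i * Q) (hQ : Q * i = i * P) :
    c • (P - Q) * i = -i * c • (P - Q) ∧ Commute i (c • (P - Q) * c • (P - Q)) := by
  have h : c • (P - Q) * i = -i * c • (P - Q) := by
    rw [smul_mul_assoc, mul_smul_comm, sub_mul, hP, hQ, neg_mul, mul_sub, neg_sub]
  refine ⟨h, ?_⟩
  change i * (c • (P - Q) * c • (P - Q)) = c • (P - Q) * c • (P - Q) * i
  rw [mul_assoc _ _ i, h, ← mul_assoc _ (-i), mul_neg, h, neg_mul, neg_mul, neg_mul, neg_neg, mul_assoc]

/-- The polar decomposition of the difference of two projections `P` and `Q` exchanges `P` and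
`1 - Q`, and it anticommutes with every operator exchanging `P` and `Q`. -/
theorem ContinuousLinearMap.exists_polar_sub {P Q : E →L[ℝ] E} (hP : IsSelfAdjoint P)
    (hQ : IsSelfAdjoint Q) (hPP : P * P = P) (hQQ : Q * Q = Q) (hP1 : ‖P‖ ≤ 1) (hQ1 : ‖Q‖ ≤ 1)
    (hinj : ∀ x, P x = Q x → x = 0) :
    ∃ J : E ≃ₗᵢ[ℝ] E, (∀ x, J (P x) = J x - Q (J x)) ∧
      ∀ i : E →L[ℝ] E, P * i = i * Q → Q * i = i * P → ∀ x, J (i x) = -i (J x) := by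
  -- The factor 1/2 makes the difference of two contractions a contraction.
  obtain ⟨T, hT⟩ : ∃ T : E →L[ℝ] E, T = (2⁻¹ : ℝ) • (P - Q) := ⟨_, rfl⟩
  obtain ⟨hTP, hcP⟩ := smul_sub_mul_of_idempotent 2⁻¹ hPP hQQ
  rw [← hT] at hTP hcP
  have hsa : IsSelfAdjoint T := hT ▸ (IsSelfAdjoint.all (2⁻¹ : ℝ)).smul (hP.sub hQ)
  have hnorm : ‖T‖ ≤ 1 := by
    have h1 : ‖P - Q‖ ≤ 1 + 1 := (norm_sub_le P Q).trans (add_le_add hP1 hQ1)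
    rw [hT, norm_smul, Real.norm_of_nonneg (by norm_num)]
    linarith
  have hTinj : Function.Injective T := (injective_iff_map_eq_zero T).2 fun x hx => by
    rw [hT] at hx
    have : (2⁻¹ : ℝ) • (P x - Q x) = 0 := hx
    rw [smul_eq_zero_iff_right (by norm_num), sub_eq_zero] at this
    exact hinj x this
  obtain ⟨J, hJ⟩ := exists_polar hsa hnorm hTinj
  refine ⟨J, hJ P (1 - Q) hTP hcP, fun i hPi hQi => ?_⟩
  obtain ⟨hTi, hci⟩ := smul_sub_mul_of_exchange 2⁻¹ hPi hQi
  rw [← hT] at hTi hci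
  exact hJ i (-i) hTi hci

end Polar

/-! ### Consequences of V + iV = H, and maximal standard subspaces. -/

namespace StandardSubspace

section
open scoped ClosedSubmodule

variable {H : Type*} [NormedAddCommGroup H] [InnerProductSpace ℂ H]

theorem mem_mulI_iff (S : ClosedSubmodule ℝ H) (x : H) :
    x ∈ S.mulI ↔ ∃ y ∈ S, Complex.I • y = x := by
  rw [ClosedSubmodule.mem_mapEquiv_iff, scalarSMulCLE_symm_apply]
  refine ⟨fun h => ⟨_, h, smul_inv_smul Complex.UnitI x⟩, ?_⟩
  rintro ⟨y, hy, rfl⟩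
  have : (Complex.UnitI⁻¹ : ℂˣ) • (Complex.I • y) = y := inv_smul_smul Complex.UnitI y
  rwa [this]

/-- A separating closed subspace that contains a standard subspace is standard. -/
def ofLE (V : StandardSubspace H) (K : ClosedSubmodule ℝ H) (h : V.toClosedSubmodule ≤ K)
    (hK : ∀ x ∈ K, Complex.I • x ∈ K → x = 0) : StandardSubspace H where
  toClosedSubmodule := K
  IsSeparating := by
    refine le_antisymm (fun x hx => ?_) bot_le
    obtain ⟨h1, h2⟩ := hx
    obtain ⟨y, hy, rfl⟩ := (mem_mulI_iff K x).1 h2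
    have := hK y hy h1
    simp [this]
  IsCyclic := by
    rw [eq_top_iff, ← V.IsCyclic]
    refine sup_le_sup h fun x hx => ?_
    obtain ⟨y, hy, rfl⟩ := (mem_mulI_iff _ x).1 hx
    exact (mem_mulI_iff K _).2 ⟨y, h hy, rfl⟩

variable (V : StandardSubspace H)

theorem eq_of_forall_le_of_addI_eq_top (hV : V.addI = ⊤) (K : StandardSubspace H)
    (h : V.toClosedSubmodule ≤ K.toClosedSubmodule) : K = V := by
  apply toClosedSubmodule_injective
  refine le_antisymm (fun z hz => ?_) h
  obtain ⟨x, hx, y, hy, hxy⟩ : z ∈ V.addI := hV ▸ Submodule.mem_top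
  have := K.decomp_unique (h hx) (h hy) hz (zero_mem _) (by simpa using hxy)
  exact this.1 ▸ hx

/-- For w outside V + iV, the closed space V + ℝw is still separating: i(v + tw) = v' + t'w gives
(t' - ti)w = iv - v' in V + iV, so t = t' = 0. -/
theorem addI_eq_top_of_forall_le [CompleteSpace H]
    (hV : ∀ K : StandardSubspace H, V.toClosedSubmodule ≤ K.toClosedSubmodule → K = V) :
    V.addI = ⊤ := by
  by_contra hne
  obtain ⟨w, hw⟩ : ∃ w, w ∉ V.addI := by
    by_contra! h
    exact hne (eq_top_iff.2 fun x _ => h x)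
  let K : ClosedSubmodule ℝ H := ⟨V.toClosedSubmodule.toSubmodule ⊔ Submodule.span ℝ {w},
    Submodule.isClosed_sup_finiteDimensional _ _ V.toClosedSubmodule.isClosed'⟩
  have hVK : V.toClosedSubmodule ≤ K := fun x hx => Submodule.mem_sup_left hx
  have hK : ∀ x ∈ K, Complex.I • x ∈ K → x = 0 := by
    intro x hx hix
    obtain ⟨v, hv, t, ht, rfl⟩ := Submodule.mem_sup.1 hx
    obtain ⟨v', hv', t', ht', h⟩ := Submodule.mem_sup.1 hix
    obtain ⟨t, rfl⟩ := Submodule.mem_span_singleton.1 ht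
    obtain ⟨t', rfl⟩ := Submodule.mem_span_singleton.1 ht'
    have hmem : ((t' : ℂ) - t * Complex.I) • w ∈ V.addI := by
      refine ⟨-v', V.toClosedSubmodule.toSubmodule.neg_mem hv', v, hv, ?_⟩
      rw [← Complex.coe_smul, ← Complex.coe_smul] at h
      rw [sub_smul, eq_sub_of_add_eq' h]
      module
    have h0 : (t' : ℂ) - t * Complex.I = 0 := by
      by_contra hc
      exact hw ((V.addI.smul_mem_iff hc).1 hmem)
    have ht0 : t = 0 := by simpa using congrArg Complex.im h0
    have ht0' : t' = 0 := by simpa using congrArg Complex.re h0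
    subst ht0 ht0'
    have := V.decomp_unique hv' (zero_mem _) (zero_mem _) hv (by simpa using h)
    simp [← this.2]
  have := hV (V.ofLE K hVK hK) hVK
  have hwV : w ∈ V.toClosedSubmodule := by
    rw [← this]
    exact Submodule.mem_sup_right (Submodule.mem_span_singleton_self w)
  exact hw ⟨w, hwV, 0, zero_mem _, by simp⟩

/-- The real-linear map `(x, y) ↦ x + i y` on `V × V`. -/
noncomputable def addIMap :
    V.toClosedSubmodule.toSubmodule × V.toClosedSubmodule.toSubmodule →L[ℝ] H :=
  (V.toClosedSubmodule.toSubmodule.subtypeL).coprod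
    ((scalarSMulCLE H Complex.UnitI : H →L[ℝ] H) ∘L V.toClosedSubmodule.toSubmodule.subtypeL)

theorem addIMap_injective : Function.Injective V.addIMap := by
  rintro ⟨x, y⟩ ⟨x', y'⟩ h
  have := V.decomp_unique x.2 y.2 x'.2 y'.2 h
  exact Prod.ext (Subtype.ext this.1) (Subtype.ext this.2)

/-- If `V + i V = H`, the map `(x, y) ↦ x + i y` is an isomorphism of real Banach spaces. -/
noncomputable def addIEquiv [CompleteSpace H] (hV : V.addI = ⊤) :
    (V.toClosedSubmodule.toSubmodule × V.toClosedSubmodule.toSubmodule) ≃L[ℝ] H :=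
  haveI : CompleteSpace V.toClosedSubmodule.toSubmodule :=
    inferInstanceAs (CompleteSpace V.toClosedSubmodule)
  ContinuousLinearEquiv.ofBijective V.addIMap
    (LinearMap.ker_eq_bot.2 V.addIMap_injective) (by
      refine eq_top_iff.2 fun z _ => ?_
      obtain ⟨x, hx, y, hy, hxy⟩ : z ∈ V.addI := hV ▸ Submodule.mem_top
      exact ⟨(⟨x, hx⟩, ⟨y, hy⟩), hxy⟩)

theorem addIEquiv_apply [CompleteSpace H] (hV : V.addI = ⊤)
    (p : V.toClosedSubmodule.toSubmodule × V.toClosedSubmodule.toSubmodule) :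
    V.addIEquiv hV p = p.1 + Complex.I • (p.2 : H) := rfl

/-- The isomorphism V × V → H sends the closed set K × K onto K + iK, which is therefore closed as
well as dense. -/
theorem eq_of_forall_ge_of_addI_eq_top [CompleteSpace H] (hV : V.addI = ⊤) (K : StandardSubspace H)
    (h : K.toClosedSubmodule ≤ V.toClosedSubmodule) : K = V := by
  apply toClosedSubmodule_injective
  refine le_antisymm h fun v hv => ?_
  have himg : (K.addI : Set H) = V.addIEquiv hV ''
      {p | (p.1 : H) ∈ K.toClosedSubmodule ∧ (p.2 : H) ∈ K.toClosedSubmodule} := by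
    ext z
    constructor
    · rintro ⟨x, hx, y, hy, rfl⟩
      exact ⟨(⟨x, h hx⟩, ⟨y, h hy⟩), ⟨hx, hy⟩, rfl⟩
    · rintro ⟨⟨x, y⟩, ⟨hx, hy⟩, rfl⟩
      exact ⟨x, hx, y, hy, rfl⟩
  have hclosed : IsClosed (K.addI : Set H) := by
    rw [himg]
    refine (V.addIEquiv hV).toHomeomorph.isClosedMap _ (IsClosed.inter ?_ ?_)
    · exact K.toClosedSubmodule.isClosed.preimage (continuous_subtype_val.comp continuous_fst)
    · exact K.toClosedSubmodule.isClosed.preimage (continuous_subtype_val.comp continuous_snd)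
  obtain ⟨x, hx, y, hy, hxy⟩ : v ∈ K.addI := by
    have := K.dense_addI.closure_eq
    rw [hclosed.closure_eq] at this
    exact this.symm.subset (Set.mem_univ v)
  have := V.decomp_unique (h hx) (h hy) hv (zero_mem _) (by simpa using hxy)
  exact this.1 ▸ hx

theorem isBddOp_modularOp_of_addI_eq_top [CompleteSpace H] (hV : V.addI = ⊤) :
    V.modularOp.IsBddOp := by
  obtain ⟨C, hC, hb⟩ : ∃ C : ℝ, 0 ≤ C ∧
      ∀ z : V.tomitaOp.domain, ‖V.tomitaOp z‖ ≤ C * ‖(z : H)‖ := by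
    -- The factor 2 appears because V × V carries the sup norm.
    refine ⟨2 * ‖(V.addIEquiv hV).symm.toContinuousLinearMap‖, by positivity, fun z => ?_⟩
    set p := (V.addIEquiv hV).symm (z : H) with hp
    have hz : (p.1 : H) + Complex.I • (p.2 : H) = z := by
      rw [← V.addIEquiv_apply hV, hp, ContinuousLinearEquiv.apply_symm_apply]
    rw [V.tomitaOp_apply z p.1.2 p.2.2 hz]
    have h1 : ‖p‖ ≤ ‖(V.addIEquiv hV).symm.toContinuousLinearMap‖ * ‖(z : H)‖ :=
      (V.addIEquiv hV).symm.toContinuousLinearMap.le_opNorm (z : H)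
    calc ‖(p.1 : H) - Complex.I • (p.2 : H)‖ ≤ ‖(p.1 : H)‖ + ‖Complex.I • (p.2 : H)‖ := norm_sub_le _ _
      _ = ‖p.1‖ + ‖p.2‖ := by rw [norm_smul, Complex.norm_I, one_mul]; rfl
      _ ≤ ‖p‖ + ‖p‖ := add_le_add (norm_fst_le p) (norm_snd_le p)
      _ ≤ _ := by linarith
  refine ⟨C * C, fun x => ?_⟩
  have hx := V.modularOp.mem_graph x
  rw [graph_modularOp] at hx
  obtain ⟨x', hx', h⟩ := hx
  simp only at hx' h
  set w := V.modularOp x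
  -- As σ_V is everywhere defined, w = Δ_V x can be tested against itself: ‖w‖² = ⟪σ_V w, σ_V x⟫.
  let w' : V.tomitaOp.domain := ⟨w, (hV ▸ Submodule.mem_top : w ∈ V.addI)⟩
  have h2 : ‖w‖ * ‖w‖ ≤ ‖w‖ * (C * C * ‖(x : H)‖) := by
    calc ‖w‖ * ‖w‖ = ‖⟪w, w⟫‖ := by rw [inner_self_eq_norm_sq_to_K]; simp [sq]
      _ = ‖⟪V.tomitaOp w', V.tomitaOp x'⟫‖ := by rw [h w']
      _ ≤ ‖V.tomitaOp w'‖ * ‖V.tomitaOp x'‖ := norm_inner_le_norm _ _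
      _ ≤ (C * ‖w‖) * (C * ‖(x' : H)‖) := by gcongr <;> apply hb
      _ = _ := by rw [hx']; ring
  rcases (norm_nonneg w).eq_or_lt with h0 | h0
  · rw [← h0]; positivity
  · exact le_of_mul_le_mul_left h2 h0

/-! ### The projections onto V and iV, and the resolvent of Δ_V. -/

theorem real_inner_smul_I (x y : H) :
    inner ℝ (Complex.I • x) (Complex.I • y) = inner ℝ x y := by
  simp only [ClosedSubmodule.inner_real_eq_re_inner, inner_smul_left, inner_smul_right]
  simp [← mul_assoc]

theorem mem_mulI {x : H} (hx : x ∈ V.toClosedSubmodule) :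
    Complex.I • x ∈ V.mulI.toClosedSubmodule :=
  (mem_mulI_iff _ _).2 ⟨x, hx, rfl⟩

variable [CompleteSpace H]

instance : CompleteSpace V.toClosedSubmodule.toSubmodule :=
  inferInstanceAs (CompleteSpace V.toClosedSubmodule)

/-- The real-orthogonal projection onto a standard subspace. -/
noncomputable def proj : H →L[ℝ] H := V.toClosedSubmodule.toSubmodule.starProjection

theorem proj_mem (x : H) : V.proj x ∈ V.toClosedSubmodule :=
  Submodule.starProjection_apply_mem _ x

theorem proj_eq_self_iff {x : H} : V.proj x = x ↔ x ∈ V.toClosedSubmodule :=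
  Submodule.starProjection_eq_self_iff

theorem proj_mul_proj : V.proj * V.proj = V.proj := by
  ext x
  exact V.proj_eq_self_iff.2 (V.proj_mem x)

theorem isSelfAdjoint_proj : IsSelfAdjoint V.proj :=
  isSelfAdjoint_starProjection _

theorem inner_proj (x : H) {y : H} (hy : y ∈ V.toClosedSubmodule) :
    inner ℝ (V.proj x) y = inner ℝ x y := by
  have := Submodule.starProjection_inner_eq_zero (K := V.toClosedSubmodule.toSubmodule) x y hy
  rw [inner_sub_left, sub_eq_zero] at this
  exact this.symm

theorem norm_proj_le : ‖V.proj‖ ≤ 1 :=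
  Submodule.starProjection_norm_le _

theorem proj_mulI_smul_I (x : H) : V.mulI.proj (Complex.I • x) = Complex.I • V.proj x := by
  refine Submodule.eq_starProjection_of_mem_of_inner_eq_zero (V.mem_mulI (V.proj_mem x)) ?_
  intro w hw
  obtain ⟨y, hy, rfl⟩ := (mem_mulI_iff _ w).1 hw
  rw [← smul_sub, real_inner_smul_I, inner_sub_left, V.inner_proj x hy, sub_self]

theorem proj_smul_I (x : H) : V.proj (Complex.I • x) = Complex.I • V.mulI.proj x := by
  have h := V.proj_mulI_smul_I (Complex.I • x)
  rw [smul_smul, Complex.I_mul_I, neg_one_smul, map_neg] at h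
  rw [neg_eq_iff_eq_neg.1 h, smul_neg, smul_smul, Complex.I_mul_I, neg_one_smul, neg_neg]

/-- The common value lies in V ∩ iV = 0, so x is real-orthogonal to V and to iV, hence
complex-orthogonal to the dense space V + iV. This makes P - Q injective. -/
theorem eq_zero_of_proj_eq_proj {x : H} (h : V.proj x = V.mulI.proj x) : x = 0 := by
  obtain ⟨y, hy, hxy⟩ := (mem_mulI_iff _ _).1 (V.mulI.proj_mem x)
  have h0 : V.proj x = 0 :=
    (V.decomp_unique (V.proj_mem x) (zero_mem _) (zero_mem _) hy (by simp [h, hxy])).1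
  refine V.dense_addI.eq_zero_of_inner_left (𝕜 := ℂ) fun v hv => ?_
  obtain ⟨a, ha, b, hb, rfl⟩ := hv
  have key : ∀ y ∈ V.toClosedSubmodule, ⟪x, y⟫ = 0 := fun y hy => by
    have h1 := V.inner_proj x hy
    have h2 := V.mulI.inner_proj x (V.mem_mulI hy)
    rw [h0, inner_zero_left, ClosedSubmodule.inner_real_eq_re_inner] at h1
    rw [← h, h0, inner_zero_left, ClosedSubmodule.inner_real_eq_re_inner, inner_smul_right] at h2
    apply Complex.ext
    · simpa using h1.symm
    · simpa using h2
  rw [inner_add_right, inner_smul_right, key a ha, key b hb, mul_zero, add_zero]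

theorem mem_addI_proj_add_proj (x : H) : V.proj x + V.mulI.proj x ∈ V.addI := by
  obtain ⟨y, hy, hxy⟩ := (mem_mulI_iff _ _).1 (V.mulI.proj_mem x)
  exact ⟨_, V.proj_mem x, y, hy, by rw [hxy]⟩

/-- The bounded operator `(1 + Δ_V)⁻¹` is half the sum of the real-orthogonal projections onto
`V` and `i V`. -/
theorem proj_add_proj_mem_graph (h : H) :
    ((2⁻¹ : ℂ) • (V.proj h + V.mulI.proj h), h - (2⁻¹ : ℂ) • (V.proj h + V.mulI.proj h)) ∈
      V.modularOp.graph := by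
  rw [graph_modularOp]
  obtain ⟨q, hq, hqI⟩ := (mem_mulI_iff _ _).1 (V.mulI.proj_mem h)
  let z : V.tomitaOp.domain := ⟨V.proj h + V.mulI.proj h, V.mem_addI_proj_add_proj h⟩
  have hz : V.tomitaOp z = V.proj h - V.mulI.proj h := by
    rw [V.tomitaOp_apply z (V.proj_mem h) hq (by rw [hqI]), hqI]
  refine ⟨(2⁻¹ : ℂ) • z, rfl, fun y => ?_⟩
  -- Pairing with a and with ia shows that P preserves Re⟪h, a⟫ and Q preserves Im⟪h, a⟫.
  have key : ∀ a ∈ V.toClosedSubmodule,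
      ⟪a, V.proj h - V.mulI.proj h⟫ = ⟪h + h - (V.proj h + V.mulI.proj h), a⟫ := by
    intro a ha
    have h1 := V.inner_proj h ha
    have h2 := V.mulI.inner_proj h (V.mem_mulI ha)
    simp only [ClosedSubmodule.inner_real_eq_re_inner, inner_smul_right, Complex.mul_re,
      Complex.I_re, Complex.I_im, zero_mul, one_mul, zero_sub, neg_inj] at h1 h2
    have sre : ∀ x, ⟪a, x⟫.re = ⟪x, a⟫.re := fun x =>
      (congrArg Complex.re (inner_conj_symm a x)).symm
    have sim : ∀ x, ⟪a, x⟫.im = -⟪x, a⟫.im := fun x =>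
      (congrArg Complex.im (inner_conj_symm a x)).symm
    rw [inner_sub_right, inner_sub_left, inner_add_left, inner_add_left]
    apply Complex.ext
    · simp only [Complex.sub_re, Complex.add_re, sre, h1]; ring
    · simp only [Complex.sub_im, Complex.add_im, sim, h2]; ring
  obtain ⟨a, ha, b, hb, hab⟩ := y.2
  rw [V.tomitaOp_apply y ha hb hab, LinearPMap.map_smulₛₗ, hz, ← hab]
  have e : h - (2⁻¹ : ℂ) • (V.proj h + V.mulI.proj h)
      = (2⁻¹ : ℂ) • (h + h - (V.proj h + V.mulI.proj h)) := by module
  simp only [e]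
  rw [inner_smul_left, inner_smul_right, inner_sub_left, inner_smul_left, key a ha, key b hb,
    inner_add_right, inner_smul_right, Complex.conj_I]
  ring

theorem addI_eq_top_of_isBddOp_modularOp (hV : V.modularOp.IsBddOp) : V.addI = ⊤ := by
  obtain ⟨C, hC⟩ := hV
  set R : H →L[ℝ] H := V.proj + V.mulI.proj with hR
  have hsa : IsSelfAdjoint R := V.isSelfAdjoint_proj.add V.mulI.isSelfAdjoint_proj
  -- With z = Rh/2, h = z + Δ_V z. The lower bound makes R injective with closed range;
  -- selfadjointness makes the range dense.
  have hbd : ∀ h, ‖h‖ ≤ ((C + 1) / 2) * ‖R h‖ := fun h => by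
    obtain ⟨z, hz, hz'⟩ := (LinearPMap.mem_graph_iff _).1 (V.proj_add_proj_mem_graph h)
    simp only at hz hz'
    have h1 := hC z
    rw [hz', hz] at h1
    have h2 : ‖(2⁻¹ : ℂ) • (V.proj h + V.mulI.proj h)‖ = 2⁻¹ * ‖R h‖ := by
      rw [norm_smul]; simp [hR]
    rw [h2] at h1
    have h3 := norm_le_norm_sub_add h ((2⁻¹ : ℂ) • (V.proj h + V.mulI.proj h))
    rw [h2] at h3
    linarith
  have hanti : AntilipschitzWith (Real.toNNReal ((C + 1) / 2)) R :=
    R.antilipschitz_of_bound fun x => (hbd x).trans (by gcongr; exact Real.le_coe_toNNReal _)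
  have hclosed : IsClosed (Set.range R) := hanti.isClosed_range R.uniformContinuous
  have hdense := hsa.denseRange_of_injective hanti.injective
  refine eq_top_iff.2 fun z _ => ?_
  have : z ∈ Set.range R := by
    rw [← hclosed.closure_eq, hdense.closure_eq]; trivial
  obtain ⟨h, rfl⟩ := this
  exact V.mem_addI_proj_add_proj h

/-! ### Modular conjugations, symplectic complements and S_V. -/

/-- The modular conjugation: a conjugate-linear isometry which maps a standard subspace onto its
symplectic complement. -/
theorem exists_modularConj : ∃ J : H ≃ₗᵢ[ℝ] H, (∀ x, J (Complex.I • x) = -(Complex.I • J x)) ∧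
    ∀ x, J x ∈ V.symplComp.toClosedSubmodule ↔ x ∈ V.toClosedSubmodule := by
  obtain ⟨J, hJP, hJi⟩ := ContinuousLinearMap.exists_polar_sub V.isSelfAdjoint_proj
    V.mulI.isSelfAdjoint_proj V.proj_mul_proj V.mulI.proj_mul_proj V.norm_proj_le
    V.mulI.norm_proj_le fun x => V.eq_zero_of_proj_eq_proj
  refine ⟨J, hJi (scalarSMulCLE H Complex.UnitI).toContinuousLinearMap
    (ContinuousLinearMap.ext V.proj_smul_I) (ContinuousLinearMap.ext V.proj_mulI_smul_I),
    fun x => ?_⟩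
  have hmem : ∀ y, y ∈ V.symplComp.toClosedSubmodule ↔ V.mulI.proj y = 0 := fun y =>
    (Submodule.starProjection_apply_eq_zero_iff (K := V.mulI.toClosedSubmodule.toSubmodule)).symm
  -- As JP = (1 - Q)J, the condition Px = x becomes QJx = 0.
  rw [hmem, ← V.proj_eq_self_iff, ← J.injective.eq_iff (a := V.proj x), hJP, sub_eq_self]

theorem symplComp_le_symplComp {V K : StandardSubspace H}
    (h : K.toClosedSubmodule ≤ V.toClosedSubmodule) :
    V.symplComp.toClosedSubmodule ≤ K.symplComp.toClosedSubmodule := fun x hx => by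
  have hx' := (ClosedSubmodule.mem_symplComp_iff (S := V.toClosedSubmodule)).1 hx
  exact (ClosedSubmodule.mem_symplComp_iff (S := K.toClosedSubmodule)).2 fun y hy => hx' y (h hy)

/-- If `K ⊆ V` are standard subspaces, the canonical unitary `J_K J_V` maps `V` into `K`. -/
theorem exists_unitary_map_le {V K : StandardSubspace H}
    (h : K.toClosedSubmodule ≤ V.toClosedSubmodule) :
    ∃ U : unitary (H →L[ℂ] H), ∀ v ∈ V.toClosedSubmodule,
      (U : H →L[ℂ] H) v ∈ K.toClosedSubmodule := by
  obtain ⟨J, hJ, hJV⟩ := V.exists_modularConj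
  obtain ⟨J', hJ', hJK⟩ := K.exists_modularConj
  let e : H ≃ₗᵢ[ℝ] H := J.trans J'.symm
  have heI : ∀ x, e (Complex.I • x) = Complex.I • e x := fun x => by
    refine J'.injective ?_
    rw [hJ']
    change J' (J'.symm (J _)) = -(Complex.I • J' (J'.symm (J x)))
    rw [J'.apply_symm_apply, J'.apply_symm_apply, hJ]
  have he : ∀ (c : ℂ) x, e (c • x) = c • e x := fun c x => by
    rw [← Complex.re_add_im c, add_smul, add_smul, mul_smul, mul_smul, Complex.coe_smul,
      Complex.coe_smul, Complex.coe_smul, Complex.coe_smul, e.map_add, e.map_smul, e.map_smul, heI]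
  let e' : H ≃ₗᵢ[ℂ] H :=
    { toFun := e, map_add' := e.map_add, map_smul' := he, invFun := e.symm
      left_inv := e.symm_apply_apply, right_inv := e.apply_symm_apply, norm_map' := e.norm_map }
  refine ⟨Unitary.linearIsometryEquiv.symm e', fun v hv => ?_⟩
  change J'.symm (J v) ∈ _
  rw [← hJK, J'.apply_symm_apply]
  exact symplComp_le_symplComp h ((hJV v).2 hv)

theorem forall_ge_iff_addI_eq_top :
    (∀ K : StandardSubspace H, K.toClosedSubmodule ≤ V.toClosedSubmodule → K = V) ↔
      V.addI = ⊤ := by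
  have aux : ∀ V : StandardSubspace H,
      (∀ K : StandardSubspace H, K.toClosedSubmodule ≤ V.toClosedSubmodule → K = V) →
      V.symplComp.addI = ⊤ := fun V hV => V.symplComp.addI_eq_top_of_forall_le fun K hK => by
    have := hV K.symplComp (by
      conv_rhs => rw [← V.symplComp_symplComp_eq]
      exact symplComp_le_symplComp hK)
    rw [← this, symplComp_symplComp_eq]
  refine ⟨fun hV => ?_, fun hV K => V.eq_of_forall_ge_of_addI_eq_top hV K⟩
  rw [← V.symplComp_symplComp_eq]
  -- `aux` only reaches the complement V'. Since V' + iV' = H makes V' minimal, `aux` applies again,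
  -- to V', and returns to V.
  exact aux _ fun K hK => V.symplComp.eq_of_forall_ge_of_addI_eq_top (aux V hV) K hK

/-- The image of a standard subspace under a complex-linear isomorphism. -/
noncomputable def mapEquiv (u : H ≃L[ℝ] H) (hu : ∀ x, u (Complex.I • x) = Complex.I • u x) :
    StandardSubspace H :=
  have h : (V.toClosedSubmodule.mapEquiv u).mulI = V.toClosedSubmodule.mulI.mapEquiv u := by
    ext x
    change x ∈ (V.toClosedSubmodule.mapEquiv u).mulI ↔ x ∈ V.toClosedSubmodule.mulI.mapEquiv u
    rw [mem_mulI_iff, ClosedSubmodule.mem_mapEquiv_iff u, mem_mulI_iff]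
    constructor
    · rintro ⟨y, hy, rfl⟩
      refine ⟨_, (ClosedSubmodule.mem_mapEquiv_iff u _ y).1 hy, u.injective ?_⟩
      rw [hu, u.apply_symm_apply, u.apply_symm_apply]
    · rintro ⟨y, hy, h⟩
      exact ⟨u y, (ClosedSubmodule.mem_mapEquiv_iff' u _ y).2 hy, by
        rw [← hu, h, u.apply_symm_apply]⟩
  { toClosedSubmodule := V.toClosedSubmodule.mapEquiv u
    IsSeparating := by
      rw [h, ← ClosedSubmodule.mapEquiv_inf_eq, V.IsSeparating, ClosedSubmodule.mapEquiv_bot_eq_bot]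
    IsCyclic := by
      rw [h, ← ClosedSubmodule.mapEquiv_sup_eq, V.IsCyclic, ClosedSubmodule.mapEquiv_top_eq_top] }

/-- If U maps V into K and U⁻¹V ⊆ V, then V = U U⁻¹V ⊆ K. Conversely, for U in S_V the space UV is
standard and contained in V, so minimality gives UV = V. -/
theorem exists_subgroup_eq_unitaryEnd_iff :
    (∃ G : Subgroup (unitary (H →L[ℂ] H)), G.toSubmonoid = V.unitaryEnd) ↔
      ∀ K : StandardSubspace H, K.toClosedSubmodule ≤ V.toClosedSubmodule → K = V := by
  constructor
  · rintro ⟨G, hG⟩ K hK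
    obtain ⟨U, hU⟩ := exists_unitary_map_le hK
    have hUV : U ∈ V.unitaryEnd := fun v hv => hK (hU v hv)
    have hUinv : U⁻¹ ∈ V.unitaryEnd := by
      rw [← hG] at hUV ⊢
      exact G.inv_mem hUV
    refine toClosedSubmodule_injective (le_antisymm hK fun v hv => ?_)
    have := hU _ (hUinv v hv)
    have e : (U : H →L[ℂ] H) (((U⁻¹ : unitary (H →L[ℂ] H)) : H →L[ℂ] H) v) = v :=
      congr(((($(mul_inv_cancel U)) : unitary (H →L[ℂ] H)) : H →L[ℂ] H) v)
    rwa [e] at this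
  · intro hV
    refine ⟨{ V.unitaryEnd with inv_mem' := fun {U} hU v hv => ?_ }, rfl⟩
    have e : ∀ x, ((U⁻¹ : unitary (H →L[ℂ] H)) : H →L[ℂ] H) ((U : H →L[ℂ] H) x) = x := fun x =>
      congr(((($(inv_mul_cancel U)) : unitary (H →L[ℂ] H)) : H →L[ℂ] H) x)
    let u : H ≃L[ℝ] H := (Unitary.linearIsometryEquiv U).toContinuousLinearEquiv.restrictScalars ℝ
    have hKV : (V.mapEquiv u fun x => (U : H →L[ℂ] H).map_smul _ x) = V := hV _ fun x hx => by
      have := hU _ ((ClosedSubmodule.mem_mapEquiv_iff u _ x).1 hx)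
      rwa [show (U : H →L[ℂ] H) (u.symm x) = x from u.apply_symm_apply x] at this
    have hv' : v ∈ (V.mapEquiv u fun x => (U : H →L[ℂ] H).map_smul _ x).toClosedSubmodule := by
      rwa [hKV]
    exact (ClosedSubmodule.mem_mapEquiv_iff u _ v).1 hv'

end

end StandardSubspace

theorem lemma2p1 {H : Type*} [NormedAddCommGroup H] [InnerProductSpace ℂ H] [CompleteSpace H]
    (V : StandardSubspace H) :
    List.TFAE [
      V.modularOp.IsBddOp,
      ∀ z : H, ∃ x ∈ V.toClosedSubmodule, ∃ y ∈ V.toClosedSubmodule, x + Complex.I • y = z,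
      ∀ K : StandardSubspace H, V.toClosedSubmodule ≤ K.toClosedSubmodule → K = V,
      ∀ K : StandardSubspace H, K.toClosedSubmodule ≤ V.toClosedSubmodule → K = V,
      ∃ G : Subgroup (unitary (H →L[ℂ] H)), G.toSubmonoid = V.unitaryEnd] := by
  have hb : (∀ z : H, ∃ x ∈ V.toClosedSubmodule, ∃ y ∈ V.toClosedSubmodule,
      x + Complex.I • y = z) ↔ V.addI = ⊤ := (Submodule.eq_top_iff' (p := V.addI)).symm
  rw [hb]
  tfae_have 1 ↔ 2 :=
    ⟨V.addI_eq_top_of_isBddOp_modularOp, V.isBddOp_modularOp_of_addI_eq_top⟩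
  tfae_have 3 ↔ 2 := ⟨V.addI_eq_top_of_forall_le, V.eq_of_forall_le_of_addI_eq_top⟩
  tfae_have 4 ↔ 2 := V.forall_ge_iff_addI_eq_top
  tfae_have 5 ↔ 4 := V.exists_subgroup_eq_unitaryEnd_iff
  tfae_finish
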